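/- All rings have an identity and ring homomorphisms preserve it. A ring extension $f : B \to A$ is a ring homomorphism; it is a *Frobenius extension* if there are a $B$-$B$-bimodule homomorphism $E : A \to B$ and finitely many elements $x_i, y_i \in A$ with $\sum_i E(a x_i) y_i = a = \sum_i x_i E(y_i a)$ for all $a \in A$. A tower of rings $C \to B \to A$ is *right* (respectively *left*) *depth three* if, for some positive integer $r$, the tensor square $A \otimes_B A$ is isomorphic to a direct summand of $A^r$ as $A$-$C$-bimodules (respectively as $C$-$A$-bimodules). A ring extension $B \to A$ is *depth two* if, for some positive integer $r$, $A \otimes_B A$ is isomorphic to a direct summand of $A^r$ both as $A$-$B$-bimodules and (for a possibly different $r$) as $B$-$A$-bimodules. For a Frobenius extension $N \to M$ put $M_{-1} = N$, $M_0 = M$ and $M_{i+1} = \operatorname{End}\,(M_i)_{M_{i-1}}$ (endomorphisms of $M_i$ as a right $M_{i-1}$-module), with the left regular maps $M_i \to M_{i+1}$, $a \mapsto (x \mapsto ax)$, for $i \ge 0$; this is the *Jones tower* $N = M_{-1} \to M = M_0 \to M_1 \to M_2 \to \cdots$. The extension $N \to M$ *has depth $n$*, where $n > 1$, if the tower $M_{-1}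 \to M_{n-3} \to M_{n-2}$ is right or left depth three (for $n = 2$ the map $M_{-1} \to M_{-1}$ is the identity). It has *finite depth* if it has depth $n$ for some $n > 1$. **Theorem.** Let $N \to M$ be a Frobenius extension of depth $n = 2^m + 1$, where $m$ is a positive integer. Then the composite extension $N \to M_{n-2}$ is a depth two Frobenius extension, into which $N \to M$ embeds: the map $M \to M_{n-2}$ is injective. **Corollary.** Let $N \to M$ be a Frobenius extension of finite depth. Then there is $k \ge 0$ such that $N \to M_k$ is a depth two Frobenius extension and the map $M \to M_k$ is injective. -/

import Mathlib

open MulOpposite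
open scoped TensorProduct

universe u v w

namespace FrobDepth

section TensorSquare

variable {A : Type u} {B : Type v} [Ring A] [Ring B]

/-- The subgroup of `A ⊗[ℤ] A` generated by all `x b ⊗ y - x ⊗ b y`, for a ring extension
`f : B → A` (a homomorphism of rings with identity). -/
def balanced (f : B →+* A) : Submodule ℤ (A ⊗[ℤ] A) :=
  Submodule.span ℤ
    {z | ∃ (x : A) (b : B) (y : A), z = (x * f b) ⊗ₜ[ℤ] y - x ⊗ₜ[ℤ] (f b * y)}

/-- The tensor square `A ⊗_B A` of a ring extension `f : B → A` of noncommutative rings. -/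
def TensorSquare (f : B →+* A) : Type u := (A ⊗[ℤ] A) ⧸ balanced f

namespace TensorSquare

instance (f : B →+* A) : AddCommGroup (TensorSquare f) :=
  inferInstanceAs (AddCommGroup ((A ⊗[ℤ] A) ⧸ balanced f))

/-- The elementary tensor `x ⊗_B y`. -/
def tmul (f : B →+* A) (x y : A) : TensorSquare f :=
  (balanced f).mkQ (x ⊗ₜ[ℤ] y)

theorem balanced_le_left (f : B →+* A) (a : A) :
    balanced f ≤ (balanced f).comap (LinearMap.rTensor A (LinearMap.mulLeft ℤ a)) := by
  refine Submodule.span_le.2 ?_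
  rintro _ ⟨x, b, y, rfl⟩
  refine Submodule.subset_span ⟨a * x, b, y, ?_⟩
  simp [mul_assoc]

theorem balanced_le_right (f : B →+* A) (a : A) :
    balanced f ≤ (balanced f).comap (LinearMap.lTensor A (LinearMap.mulRight ℤ a)) := by
  refine Submodule.span_le.2 ?_
  rintro _ ⟨x, b, y, rfl⟩
  refine Submodule.subset_span ⟨x, b, y * a, ?_⟩
  simp [mul_assoc]

/-- Left multiplication by `a` on `A ⊗_B A`, that is `x ⊗ y ↦ a x ⊗ y`. -/
def leftMul (f : B →+* A) (a : A) : TensorSquare f →+ TensorSquare f :=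
  (Submodule.mapQ (balanced f) (balanced f)
    (LinearMap.rTensor A (LinearMap.mulLeft ℤ a)) (balanced_le_left f a)).toAddMonoidHom

/-- Right multiplication by `a` on `A ⊗_B A`, that is `x ⊗ y ↦ x ⊗ y a`. -/
def rightMul (f : B →+* A) (a : A) : TensorSquare f →+ TensorSquare f :=
  (Submodule.mapQ (balanced f) (balanced f)
    (LinearMap.lTensor A (LinearMap.mulRight ℤ a)) (balanced_le_right f a)).toAddMonoidHom

theorem leftMul_tmul (f : B →+* A) (a x y : A) :
    leftMul f a (tmul f x y) = tmul f (a * x) y := rfl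

theorem rightMul_tmul (f : B →+* A) (a x y : A) :
    rightMul f a (tmul f x y) = tmul f x (y * a) := rfl

theorem tmul_add (f : B →+* A) (x y z : A) :
    tmul f x (y + z) = tmul f x y + tmul f x z := by
  simp only [tmul, TensorProduct.tmul_add]
  exact map_add _ _ _

theorem add_tmul (f : B →+* A) (x y z : A) :
    tmul f (x + y) z = tmul f x z + tmul f y z := by
  simp only [tmul, TensorProduct.add_tmul]
  exact map_add _ _ _

theorem tmul_zero (f : B →+* A) (x : A) : tmul f x 0 = 0 := by
  simp only [tmul, TensorProduct.tmul_zero]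
  exact map_zero _

theorem zero_tmul (f : B →+* A) (x : A) : tmul f 0 x = 0 := by
  simp only [tmul, TensorProduct.zero_tmul]
  exact map_zero _

theorem mul_tmul (f : B →+* A) (x y : A) (b : B) :
    tmul f (x * f b) y = tmul f x (f b * y) :=
  (Submodule.Quotient.eq _).2 (Submodule.subset_span ⟨x, b, y, rfl⟩)

theorem induction_on {f : B →+* A} {p : TensorSquare f → Prop} (t : TensorSquare f)
    (h0 : p 0) (h1 : ∀ x y, p (tmul f x y)) (h2 : ∀ s t, p s → p t → p (s + t)) : p t := by
  obtain ⟨z, rfl⟩ := Submodule.mkQ_surjective (balanced f) t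
  induction z using TensorProduct.induction_on with
  | zero => exact h0
  | tmul x y => exact h1 x y
  | add s t hs ht => exact h2 _ _ hs ht

/-- `A ⊗_B A` as a left `A`-module. -/
instance (f : B →+* A) : Module A (TensorSquare f) where
  smul a t := leftMul f a t
  one_smul t := by
    change leftMul f 1 t = t
    induction t using induction_on with
    | h0 => exact map_zero _
    | h1 x y => rw [leftMul_tmul, one_mul]
    | h2 s t hs ht => rw [map_add, hs, ht]
  mul_smul a b t := by
    change leftMul f (a * b) t = leftMul f a (leftMul f b t)
    induction t using induction_on with
    | h0 => simp only [map_zero]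
    | h1 x y => simp only [leftMul_tmul, mul_assoc]
    | h2 s t hs ht => simp only [map_add, hs, ht]
  smul_zero a := map_zero (leftMul f a)
  smul_add a := map_add (leftMul f a)
  add_smul a b t := by
    change leftMul f (a + b) t = leftMul f a t + leftMul f b t
    induction t using induction_on with
    | h0 => simp only [map_zero, add_zero]
    | h1 x y => simp only [leftMul_tmul, add_mul, add_tmul]
    | h2 s t hs ht => simp only [map_add, hs, ht]; abel
  zero_smul t := by
    change leftMul f 0 t = 0
    induction t using induction_on with
    | h0 => exact map_zero _
    | h1 x y => rw [leftMul_tmul, zero_mul, zero_tmul]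
    | h2 s t hs ht => rw [map_add, hs, ht, add_zero]

/-- `A ⊗_B A` as a right `A`-module. -/
instance (f : B →+* A) : Module Aᵐᵒᵖ (TensorSquare f) where
  smul a t := rightMul f (unop a) t
  one_smul t := by
    change rightMul f 1 t = t
    induction t using induction_on with
    | h0 => exact map_zero _
    | h1 x y => rw [rightMul_tmul, mul_one]
    | h2 s t hs ht => rw [map_add, hs, ht]
  mul_smul a b t := by
    change rightMul f (unop b * unop a) t = rightMul f (unop a) (rightMul f (unop b) t)
    induction t using induction_on with
    | h0 => simp only [map_zero]
    | h1 x y => simp only [rightMul_tmul, mul_assoc]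
    | h2 s t hs ht => simp only [map_add, hs, ht]
  smul_zero a := map_zero (rightMul f (unop a))
  smul_add a := map_add (rightMul f (unop a))
  add_smul a b t := by
    change rightMul f (unop a + unop b) t = rightMul f (unop a) t + rightMul f (unop b) t
    induction t using induction_on with
    | h0 => simp only [map_zero, add_zero]
    | h1 x y => simp only [rightMul_tmul, mul_add, tmul_add]
    | h2 s t hs ht => simp only [map_add, hs, ht]; abel
  zero_smul t := by
    change rightMul f 0 t = 0
    induction t using induction_on with
    | h0 => exact map_zero _
    | h1 x y => rw [rightMul_tmul, mul_zero, tmul_zero]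
    | h2 s t hs ht => rw [map_add, hs, ht, add_zero]

end TensorSquare

end TensorSquare

section Summand

variable {A : Type u} {R : Type v} {S : Type w} [Ring A] [Ring R] [Ring S]

/-- For `A`-`A`-bimodules `X`, `Y` and ring homomorphisms `α : R → A`, `β : S → A`: the
homomorphisms of `R`-`S`-bimodules from `X` to `Y`, where both carry the restricted actions.
A right action of `a` is the action of `op a`. -/
structure BimodHom (α : R →+* A) (β : S →+* A) (X Y : Type u)
    [AddCommGroup X] [Module A X] [Module Aᵐᵒᵖ X]
    [AddCommGroup Y] [Module A Y] [Module Aᵐᵒᵖ Y] extends X →+ Y where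
  map_left : ∀ (r : R) (x : X), toFun (α r • x) = α r • toFun x
  map_right : ∀ (s : S) (x : X), toFun (op (β s) • x) = op (β s) • toFun x

/-- `X ⊕ * ≅ Yⁿ` as `R`-`S`-bimodules for some positive integer `n`: there is a split
monomorphism of `R`-`S`-bimodules from `X` to `Yⁿ`. -/
def IsSummandOfPower (α : R →+* A) (β : S →+* A) (X Y : Type u)
    [AddCommGroup X] [Module A X] [Module Aᵐᵒᵖ X]
    [AddCommGroup Y] [Module A Y] [Module Aᵐᵒᵖ Y] : Prop :=
  ∃ n : ℕ, 0 < n ∧ ∃ (i : BimodHom α β X (Fin n → Y)) (p : BimodHom α β (Fin n → Y) X),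
    ∀ x : X, p.toFun (i.toFun x) = x

end Summand

section Depth

variable {A : Type u} {B : Type v} {C : Type w} [Ring A] [Ring B] [Ring C]

/-- The tower of rings `C → B → A` (with maps `h`, `g`) is right depth three:
`A ⊗_B A ⊕ * ≅ Aⁿ` as `A`-`C`-bimodules. -/
def IsRightD3 (g : B →+* A) (h : C →+* B) : Prop :=
  IsSummandOfPower (RingHom.id A) (g.comp h) (TensorSquare g) A

/-- The tower of rings `C → B → A` (with maps `h`, `g`) is left depth three:
`A ⊗_B A ⊕ * ≅ Aⁿ` as `C`-`A`-bimodules. -/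
def IsLeftD3 (g : B →+* A) (h : C →+* B) : Prop :=
  IsSummandOfPower (g.comp h) (RingHom.id A) (TensorSquare g) A

/-- The ring extension `f : B → A` is right depth two:
`A ⊗_B A ⊕ * ≅ Aⁿ` as `A`-`B`-bimodules. -/
def IsRightD2 (f : B →+* A) : Prop :=
  IsSummandOfPower (RingHom.id A) f (TensorSquare f) A

/-- The ring extension `f : B → A` is left depth two:
`A ⊗_B A ⊕ * ≅ Aⁿ` as `B`-`A`-bimodules. -/
def IsLeftD2 (f : B →+* A) : Prop :=
  IsSummandOfPower f (RingHom.id A) (TensorSquare f) A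

/-- A ring extension is depth two (D2) if it is both right and left depth two. -/
def IsD2 (f : B →+* A) : Prop := IsRightD2 f ∧ IsLeftD2 f

/-- `f : B → A` is a Frobenius extension: there is a Frobenius system `(E, xᵢ, yᵢ)`, that is, a
`B`-`B`-bimodule homomorphism `E : A → B` and finitely many `xᵢ, yᵢ ∈ A` with
`∑ E(a xᵢ) yᵢ = a = ∑ xᵢ E(yᵢ a)` for all `a ∈ A`. -/
def IsFrobeniusExtension (f : B →+* A) : Prop :=
  ∃ E : A →+ B,
    (∀ (b : B) (a : A), E (f b * a) = b * E a) ∧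
    (∀ (b : B) (a : A), E (a * f b) = E a * b) ∧
    ∃ (n : ℕ) (x y : Fin n → A), ∀ a : A,
      ∑ i, f (E (a * x i)) * y i = a ∧ ∑ i, x i * f (E (y i * a)) = a

/-- The ring `End A_B` of right `B`-linear endomorphisms of `A`, under composition and addition,
for a ring extension `f : B → A`. -/
def rightEnd (f : B →+* A) : Subring (AddMonoid.End A) where
  carrier := {φ | ∀ (a : A) (b : B), φ (a * f b) = φ a * f b}
  mul_mem' := by
    intro φ ψ hφ hψ a b
    change φ (ψ (a * f b)) = φ (ψ a) * f b
    rw [hψ a b, hφ (ψ a) b]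
  one_mem' := fun _ _ => rfl
  add_mem' := by
    intro φ ψ hφ hψ a b
    change φ (a * f b) + ψ (a * f b) = (φ a + ψ a) * f b
    rw [hφ a b, hψ a b, add_mul]
  zero_mem' := by
    intro a b
    change (0 : A) = 0 * f b
    rw [zero_mul]
  neg_mem' := by
    intro φ hφ a b
    change -φ (a * f b) = -φ a * f b
    rw [hφ a b, neg_mul]

/-- The left regular map `A → End A_B`, `a ↦ (x ↦ a x)`. -/
def leftRegular (f : B →+* A) : A →+* rightEnd f where
  toFun a := ⟨AddMonoidHom.mulLeft a, fun x b => (mul_assoc a x (f b)).symm⟩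
  map_one' := Subtype.ext (AddMonoidHom.ext fun x => one_mul x)
  map_mul' a b := Subtype.ext (AddMonoidHom.ext fun x => mul_assoc a b x)
  map_zero' := Subtype.ext (AddMonoidHom.ext fun x => zero_mul x)
  map_add' a b := Subtype.ext (AddMonoidHom.ext fun x => add_mul a b x)

end Depth

section JonesTower

/-- A ring extension with its two rings bundled. -/
structure RingExtension : Type (u + 1) where
  dom : Type u
  cod : Type u
  [ringDom : Ring dom]
  [ringCod : Ring cod]
  map : dom →+* cod

attribute [instance] RingExtension.ringDom RingExtension.ringCod

variable {N : Type v} {M : Type u} [Ring N] [Ring M]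

/-- The `k`-th step `M_k → M_{k+1}` (`k ≥ 0`) of the Jones tower
`N = M_{-1} → M = M_0 → M_1 → M_2 → ⋯` of `f : N → M`. Here `M_{k+1}` is the ring of
endomorphisms of `M_k` as a right `M_{k-1}`-module, and `M_k → M_{k+1}` is left regular. -/
def jonesExt (f : N →+* M) : ℕ → RingExtension.{u}
  | 0 => ⟨M, rightEnd f, leftRegular f⟩
  | k + 1 => ⟨(jonesExt f k).cod, rightEnd (jonesExt f k).map, leftRegular (jonesExt f k).map⟩

/-- The ring `M_k` (`k ≥ 0`) of the Jones tower of `f : N → M`; so `M_0 = M`. -/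
def JonesRing (f : N →+* M) (k : ℕ) : Type u := (jonesExt f k).dom

instance (f : N →+* M) (k : ℕ) : Ring (JonesRing f k) := (jonesExt f k).ringDom

/-- The map `M_k → M_{k+1}` of the Jones tower. -/
def jonesStep (f : N →+* M) (k : ℕ) : JonesRing f k →+* JonesRing f (k + 1) :=
  (jonesExt f k).map

/-- The composite map `M = M_0 → M_k` in the Jones tower. -/
def jonesIncl (f : N →+* M) : (k : ℕ) → M →+* JonesRing f k
  | 0 => RingHom.id M
  | k + 1 => (jonesStep f k).comp (jonesIncl f k)

/-- The composite map `N = M_{-1} → M_k` in the Jones tower. -/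
def jonesBase (f : N →+* M) (k : ℕ) : N →+* JonesRing f k :=
  (jonesIncl f k).comp f

/-- The extension `f : N → M` has depth `n`, for `n > 1`: the composite tower
`M_{n-2} | M_{n-3} | M_{-1}` is right or left depth three. For `n = 2` this is the tower
`M | N | N`, in which `N → N` is the identity. -/
def HasDepth (f : N →+* M) : ℕ → Prop
  | 0 => False
  | 1 => False
  | 2 => IsRightD3 f (RingHom.id N) ∨ IsLeftD3 f (RingHom.id N)
  | k + 3 => IsRightD3 (jonesStep f k) (jonesBase f k) ∨ IsLeftD3 (jonesStep f k) (jonesBase f k)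

end JonesTower

end FrobDepth

/-! Depth three is turned into a factorization of the Frobenius form. Let `E : M → N` be the
Frobenius homomorphism and let `α : N → A` be the map to a ring of the tower. `SplitForm` says that
`α (E (p q))` is a finite sum of products `γⱼ(p) βⱼ(q)` with `γⱼ, βⱼ` bimodule maps over `N`. This
condition is left-right symmetric, and both one-sided depth three conditions imply its analogue for
the step `M_{n-3} → M_{n-2}`, with `A = M_{n-2}` (`IsRightD3.split`, `IsLeftD3.split`).

Two transports remain. Downwards: the basic construction yields a Frobenius system for each step of
the tower whose dual bases are images of the original ones under `N`-bilinear maps `h, g`, with `E_k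
(g m * h m') = E (m m')` in `M_k` (`LinkedSystem.next`). Composing with `g` and `h` splits the form
of `N → M` over the same `A`. Upwards: if the forms of `N → M` and of `N → M_k` split over `A`, so
does that of `N → M_{k+1}` (`LinkedSystem.splitForm`). On reaching `A` itself, the splitting
produces both depth two decompositions of `A ⊗_N A` (`FrobeniusSystem.isD2`). -/

namespace FrobDepth

/-! ### Maps on the tensor square. -/

namespace TensorSquare

variable {A : Type u} {B : Type v} [Ring A] [Ring B]

/-- The additive map out of `A ⊗_B A` given by a `B`-balanced biadditive map. -/
def lift (f : B →+* A) {G : Type w} [AddCommGroup G] (φ : A →+ A →+ G)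
    (h : ∀ x b y, φ (x * f b) y = φ x (f b * y)) : TensorSquare f →+ G :=
  ((balanced f).liftQ (TensorProduct.liftAddHom φ fun r m n => by
    rw [map_zsmul, map_zsmul]; rfl).toIntLinearMap (by
    refine Submodule.span_le.2 ?_
    rintro _ ⟨x, b, y, rfl⟩
    simp [h])).toAddMonoidHom

@[simp]
theorem lift_tmul (f : B →+* A) {G : Type w} [AddCommGroup G] (φ : A →+ A →+ G)
    (h : ∀ x b y, φ (x * f b) y = φ x (f b * y)) (x y : A) :
    lift f φ h (tmul f x y) = φ x y := rfl

theorem smul_tmul (f : B →+* A) (a x y : A) : a • tmul f x y = tmul f (a * x) y := rfl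

theorem op_smul_tmul (f : B →+* A) (a x y : A) : op a • tmul f x y = tmul f x (y * a) := rfl

theorem smul_op_smul (f : B →+* A) (a b : A) (t : TensorSquare f) :
    a • op b • t = op b • a • t := by
  induction t using induction_on with
  | h0 => simp
  | h1 x y => simp only [smul_tmul, op_smul_tmul]
  | h2 s t hs ht => simp only [smul_add, hs, ht]

/-- The elementary tensor as a biadditive map. -/
def tmulHom (f : B →+* A) : A →+ A →+ TensorSquare f :=
  AddMonoidHom.mk' (fun x => AddMonoidHom.mk' (tmul f x) (tmul_add f x))
    fun x y => AddMonoidHom.ext fun z => add_tmul f x y z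

theorem sum_tmul (f : B →+* A) {ι : Type*} (s : Finset ι) (x : ι → A) (y : A) :
    tmul f (∑ i ∈ s, x i) y = ∑ i ∈ s, tmul f (x i) y :=
  map_sum ((tmulHom f).flip y) x s

theorem tmul_sum (f : B →+* A) {ι : Type*} (s : Finset ι) (x : A) (y : ι → A) :
    tmul f x (∑ i ∈ s, y i) = ∑ i ∈ s, tmul f x (y i) :=
  map_sum (tmulHom f x) y s

end TensorSquare

/-! ### Frobenius systems, their composition and the Casimir element. -/

/-- A Frobenius system for `f : B → A` with dual bases indexed by `ι`. -/
structure FrobeniusSystem {A : Type u} {B : Type v} [Ring A] [Ring B] (f : B →+* A)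
    (ι : Type) [Fintype ι] where
  E : A →+ B
  E_left : ∀ b a, E (f b * a) = b * E a
  E_right : ∀ b a, E (a * f b) = E a * b
  x : ι → A
  y : ι → A
  sum_left : ∀ a, ∑ i, f (E (a * x i)) * y i = a
  sum_right : ∀ a, ∑ i, x i * f (E (y i * a)) = a

namespace FrobeniusSystem

variable {A : Type u} {B : Type v} {C : Type w} [Ring A] [Ring B] [Ring C]
  {ι κ : Type} [Fintype ι] [Fintype κ]

theorem isFrobeniusExtension {f : B →+* A} (S : FrobeniusSystem f ι) :
    IsFrobeniusExtension f := by
  let e := (Fintype.equivFin ι).symm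
  refine ⟨S.E, S.E_left, S.E_right, Fintype.card ι, S.x ∘ e, S.y ∘ e, fun a => ⟨?_, ?_⟩⟩
  · exact (Equiv.sum_comp e fun i => f (S.E (a * S.x i)) * S.y i).trans (S.sum_left a)
  · exact (Equiv.sum_comp e fun i => S.x i * f (S.E (S.y i * a))).trans (S.sum_right a)

/-- The Frobenius system of a composite extension. -/
def comp {g : B →+* A} {h : C →+* B} (S : FrobeniusSystem g ι) (T : FrobeniusSystem h κ) :
    FrobeniusSystem (g.comp h) (ι × κ) where
  E := T.E.comp S.E
  E_left c a := by simp [S.E_left, T.E_left]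
  E_right c a := by simp [S.E_right, T.E_right]
  x i := S.x i.1 * g (T.x i.2)
  y i := g (T.y i.2) * S.y i.1
  sum_left a := by
    conv_rhs => rw [← S.sum_left a]
    rw [Fintype.sum_prod_type]
    refine Finset.sum_congr rfl fun i _ => ?_
    conv_rhs => rw [← T.sum_left (S.E (a * S.x i))]
    simp [← mul_assoc, S.E_right, Finset.sum_mul]
  sum_right a := by
    conv_rhs => rw [← S.sum_right a]
    rw [Fintype.sum_prod_type]
    refine Finset.sum_congr rfl fun i _ => ?_
    conv_rhs => rw [← T.sum_right (S.E (S.y i * a))]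
    simp [mul_assoc, S.E_left, Finset.mul_sum]

/-- The element `∑ xᵢ ⊗ yᵢ` is central in `A ⊗_B A`, tested against balanced biadditive maps. -/
theorem casimir {f : B →+* A} (S : FrobeniusSystem f ι) {G : Type*} [AddCommGroup G]
    (φ : A →+ A →+ G) (h : ∀ x b y, φ (x * f b) y = φ x (f b * y)) (a : A) :
    ∑ i, φ (a * S.x i) (S.y i) = ∑ i, φ (S.x i) (S.y i * a) := by
  -- Expanding `a xᵢ` on one side and `yⱼ a` on the other gives the same double sum, with
  -- coefficients `E (yⱼ a xᵢ)`.
  have h1 : ∀ i, φ (a * S.x i) (S.y i) =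
      ∑ j, φ (S.x j) (f (S.E (S.y j * a * S.x i)) * S.y i) := fun i => by
    conv_lhs => rw [← S.sum_right (a * S.x i)]
    simp [h, mul_assoc]
  have h2 : ∀ j, φ (S.x j) (S.y j * a) =
      ∑ i, φ (S.x j) (f (S.E (S.y j * a * S.x i)) * S.y i) := fun j => by
    conv_lhs => rw [← S.sum_left (S.y j * a)]
    simp
  simp only [h1, h2]
  exact Finset.sum_comm

end FrobeniusSystem

/-! ### Bimodule maps and split forms. -/

section Bilinear

variable {N : Type*} {P : Type*} {Q : Type*} [Ring N] [Ring P] [Ring Q]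

/-- The additive map `φ : P → Q` is a homomorphism of `N`-`N`-bimodules. -/
structure IsBilinear (α : N →+* P) (β : N →+* Q) (φ : P →+ Q) : Prop where
  left : ∀ n p, φ (α n * p) = β n * φ p
  right : ∀ n p, φ (p * α n) = φ p * β n

theorem IsBilinear.comp {R : Type*} [Ring R] {α : N →+* P} {β : N →+* Q} {γ : N →+* R}
    {φ : P →+ Q} {ψ : Q →+ R} (hψ : IsBilinear β γ ψ) (hφ : IsBilinear α β φ) :
    IsBilinear α γ (ψ.comp φ) :=
  ⟨fun n p => by simp [hφ.left, hψ.left], fun n p => by simp [hφ.right, hψ.right]⟩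

/-- The bilinear form `(p, q) ↦ E (p q)` on `P` is a finite sum of products `γⱼ(p) βⱼ(q)` in `A`
of `N`-`N`-bimodule homomorphisms `γⱼ, βⱼ : P → A`. -/
def SplitForm {A : Type*} [Ring A] (b : N →+* P) (E : P →+ N) (α : N →+* A) : Prop :=
  ∃ (κ : Type) (_ : Fintype κ) (γ β : κ → P →+ A),
    (∀ j, IsBilinear b α (γ j)) ∧ (∀ j, IsBilinear b α (β j)) ∧
    ∀ p q, α (E (p * q)) = ∑ j, γ j p * β j q

end Bilinear

/-! ### The basic construction and the transport of split forms. -/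

section Linked

variable {M : Type u} {N : Type v} [Ring M] [Ring N] {f : N →+* M} {ι : Type} [Fintype ι]

/-- A Frobenius system for `s : R → S`, where `b : N → R`, obtained by transporting the dual bases
of a Frobenius system for `f : N → M` along `N`-`N`-bimodule homomorphisms `M → S`. -/
structure LinkedSystem (S₀ : FrobeniusSystem f ι) {R : Type*} {S : Type*} [Ring R] [Ring S]
    (b : N →+* R) (s : R →+* S) extends FrobeniusSystem s ι where
  g : M →+ S
  h : M →+ S
  g_bilinear : IsBilinear f (s.comp b) g
  h_bilinear : IsBilinear f (s.comp b) h
  x_eq : ∀ i, x i = h (S₀.x i)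
  y_eq : ∀ i, y i = g (S₀.y i)
  E_g_mul_h : ∀ m m', E (g m * h m') = b (S₀.E (m * m'))

namespace LinkedSystem

/-- A Frobenius system is linked to itself. -/
def refl (S₀ : FrobeniusSystem f ι) : LinkedSystem S₀ (RingHom.id N) f where
  toFrobeniusSystem := S₀
  g := AddMonoidHom.id M
  h := AddMonoidHom.id M
  g_bilinear := ⟨fun _ _ => rfl, fun _ _ => rfl⟩
  h_bilinear := ⟨fun _ _ => rfl, fun _ _ => rfl⟩
  x_eq _ := rfl
  y_eq _ := rfl
  E_g_mul_h _ _ := rfl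

variable {S₀ : FrobeniusSystem f ι} {R : Type*} {S : Type u} [Ring R] [Ring S]
  {b : N →+* R} {s : R →+* S}

theorem rightEnd_ext {φ ψ : rightEnd s} (h : ∀ c, φ.1 c = ψ.1 c) : φ = ψ :=
  Subtype.ext (AddMonoidHom.ext h)

theorem sum_apply {κ : Type*} [Fintype κ] (φ : κ → rightEnd s) (c : S) :
    (∑ i, φ i).1 c = ∑ i, (φ i).1 c := by
  rw [AddSubmonoidClass.coe_finsetSum]
  exact AddMonoidHom.finsetSum_apply _ _ _

/-- The system of `S → End S_R` obtained from one of `R → S` by the basic construction. -/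
def next (L : LinkedSystem S₀ b s) : LinkedSystem S₀ (s.comp b) (leftRegular s) where
  -- Under `End S_R ≅ S ⊗_R S`, where `x ⊗ y` acts as `c ↦ x E(y c)`, this is multiplication `x ⊗ y
  -- ↦ x y`. The dual bases below are `xᵢ ⊗ 1` and `1 ⊗ yᵢ`, and the new `g`, `h` are `m ↦ 1 ⊗ g m`
  -- and `m ↦ h m ⊗ 1`.
  E := AddMonoidHom.mk' (fun φ => ∑ i, φ.1 (L.x i) * L.y i) fun φ ψ => by
    rw [← Finset.sum_add_distrib]
    exact Finset.sum_congr rfl fun i _ => add_mul (φ.1 (L.x i)) (ψ.1 (L.x i)) _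
  E_left a φ := by
    change ∑ i, a * φ.1 (L.x i) * L.y i = a * ∑ i, φ.1 (L.x i) * L.y i
    simp only [Finset.mul_sum, mul_assoc]
  E_right a φ := by
    change ∑ i, φ.1 (a * L.x i) * L.y i = (∑ i, φ.1 (L.x i) * L.y i) * a
    rw [Finset.sum_mul]
    refine (L.casimir (AddMonoidHom.mul.comp φ.1) (fun x r y => ?_) a).trans ?_
    · change φ.1 (x * s r) * y = φ.1 x * (s r * y)
      rw [φ.2 x r, mul_assoc]
    · exact Finset.sum_congr rfl fun i _ => (mul_assoc _ _ _).symm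
  x i := ⟨(AddMonoidHom.mulLeft (L.x i)).comp (s.toAddMonoidHom.comp L.E), fun c r => by
    change L.x i * s (L.E (c * s r)) = L.x i * s (L.E c) * s r
    rw [L.E_right, map_mul, mul_assoc]⟩
  y i := ⟨s.toAddMonoidHom.comp (L.E.comp (AddMonoidHom.mulLeft (L.y i))), fun c r => by
    change s (L.E (L.y i * (c * s r))) = s (L.E (L.y i * c)) * s r
    rw [← mul_assoc, L.E_right, map_mul]⟩
  sum_left φ := by
    refine rightEnd_ext fun c => ?_
    rw [sum_apply]
    change ∑ i, (∑ j, φ.1 (L.x i * s (L.E (L.x j))) * L.y j) * s (L.E (L.y i * c)) = φ.1 c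
    have h1 : ∑ j, s (L.E (L.x j)) * L.y j = 1 := by simpa using L.sum_left 1
    conv_rhs => rw [← L.sum_right c]
    rw [map_sum]
    refine Finset.sum_congr rfl fun i _ => ?_
    simp only [φ.2 _ _, mul_assoc, ← Finset.mul_sum, h1, mul_one]
  sum_right φ := by
    refine rightEnd_ext fun c => ?_
    rw [sum_apply]
    change ∑ i, L.x i * s (L.E ((∑ j, s (L.E (L.y i * φ.1 (L.x j))) * L.y j) * c)) = φ.1 c
    conv_rhs => rw [← L.sum_right c]
    simp only [Finset.sum_mul, mul_assoc, L.E_left, map_sum, map_mul, Finset.mul_sum, φ.2 _ _]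
    rw [Finset.sum_comm]
    refine Finset.sum_congr rfl fun j _ => ?_
    conv_rhs => rw [← L.sum_right (φ.1 (L.x j)), Finset.sum_mul]
    simp only [mul_assoc]
  g := AddMonoidHom.mk' (fun m =>
    ⟨s.toAddMonoidHom.comp (L.E.comp (AddMonoidHom.mulLeft (L.g m))), fun c r => by
      change s (L.E (L.g m * (c * s r))) = s (L.E (L.g m * c)) * s r
      rw [← mul_assoc, L.E_right, map_mul]⟩) fun m m' => rightEnd_ext fun c => by
        change s (L.E (L.g (m + m') * c)) = s (L.E (L.g m * c)) + s (L.E (L.g m' * c))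
        simp only [map_add, add_mul]
  h := AddMonoidHom.mk' (fun m =>
    ⟨(AddMonoidHom.mulLeft (L.h m)).comp (s.toAddMonoidHom.comp L.E), fun c r => by
      change L.h m * s (L.E (c * s r)) = L.h m * s (L.E c) * s r
      rw [L.E_right, map_mul, mul_assoc]⟩) fun m m' => rightEnd_ext fun c => by
        change L.h (m + m') * s (L.E c) = L.h m * s (L.E c) + L.h m' * s (L.E c)
        simp only [map_add, add_mul]
  g_bilinear := by
    refine ⟨fun n m => rightEnd_ext fun c => ?_, fun n m => rightEnd_ext fun c => ?_⟩
    · change s (L.E (L.g (f n * m) * c)) = s (b n) * s (L.E (L.g m * c))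
      rw [L.g_bilinear.left, mul_assoc, RingHom.comp_apply, L.E_left, map_mul]
    · change s (L.E (L.g (m * f n) * c)) = s (L.E (L.g m * (s (b n) * c)))
      rw [L.g_bilinear.right, mul_assoc, RingHom.comp_apply]
  h_bilinear := by
    refine ⟨fun n m => rightEnd_ext fun c => ?_, fun n m => rightEnd_ext fun c => ?_⟩
    · change L.h (f n * m) * s (L.E c) = s (b n) * (L.h m * s (L.E c))
      rw [L.h_bilinear.left, mul_assoc, RingHom.comp_apply]
    · change L.h (m * f n) * s (L.E c) = L.h m * s (L.E (s (b n) * c))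
      rw [L.h_bilinear.right, mul_assoc, RingHom.comp_apply, L.E_left, map_mul]
  x_eq i := rightEnd_ext fun c => congrArg (· * s (L.E c)) (L.x_eq i)
  y_eq i := rightEnd_ext fun c => congrArg (fun z => s (L.E (z * c))) (L.y_eq i)
  E_g_mul_h m m' := by
    change ∑ i, s (L.E (L.g m * (L.h m' * s (L.E (L.x i))))) * L.y i = s (b (S₀.E (m * m')))
    have h1 : ∑ j, s (L.E (L.x j)) * L.y j = 1 := by simpa using L.sum_left 1
    -- In tensor notation, `(1 ⊗ g m)(h m' ⊗ 1) = E(g m * h m') ⊗ 1`.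
    simp only [← mul_assoc (L.g m), L.E_right, L.E_g_mul_h, map_mul]
    simp only [mul_assoc, ← Finset.mul_sum, h1, mul_one]

/-- Split forms for `N → M` and `N → R` give one for the composite `N → R → S`. -/
theorem splitForm (L : LinkedSystem S₀ b s) {A : Type*} [Ring A] {α : N →+* A} {F : R →+ N}
    (h₀ : SplitForm f S₀.E α) (h₁ : SplitForm b F α) :
    SplitForm (s.comp b) (F.comp L.E) α := by
  obtain ⟨κ, _, δ, ε, hδ, hε, h₀⟩ := h₀
  obtain ⟨κ', _, γ, β, hγ, hβ, h₁⟩ := h₁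
  -- Because the dual bases come from `M`, the image of `N` acts on them through structure constants
  -- of `S₀`, which lie in `N`.
  have expand : ∀ n i, s (b n) * L.x i = ∑ k, L.x k * s (b (S₀.E (S₀.y k * f n * S₀.x i))) := by
    intro n i
    conv_lhs => rw [← L.sum_right (s (b n) * L.x i)]
    refine Finset.sum_congr rfl fun k _ => ?_
    rw [L.x_eq i, L.y_eq k, ← L.E_g_mul_h, L.g_bilinear.right, RingHom.comp_apply, mul_assoc]
  have expand' : ∀ n i, L.y i * s (b n) = ∑ k, s (b (S₀.E (S₀.y i * f n * S₀.x k))) * L.y k := by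
    intro n i
    conv_lhs => rw [← L.sum_left (L.y i * s (b n))]
    refine Finset.sum_congr rfl fun k _ => ?_
    rw [L.x_eq k, L.y_eq i, ← L.E_g_mul_h, L.g_bilinear.right, RingHom.comp_apply]
  -- The new maps are `p ↦ ∑ᵢ γ(E(p xᵢ)) δ(yᵢ)` and `q ↦ ∑ₖ ε(xₖ) β(E(yₖ q))`, where `δ, ε` are
  -- evaluated on the dual bases in `M`.
  refine ⟨κ' × κ, inferInstance,
    fun j => ∑ i, (AddMonoidHom.mulRight (δ j.2 (S₀.y i))).comp
      ((γ j.1).comp (L.E.comp (AddMonoidHom.mulRight (L.x i)))),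
    fun j => ∑ i, (AddMonoidHom.mulLeft (ε j.2 (S₀.x i))).comp
      ((β j.1).comp (L.E.comp (AddMonoidHom.mulLeft (L.y i)))),
    fun j => ⟨fun n p => ?_, fun n p => ?_⟩, fun j => ⟨fun n p => ?_, fun n p => ?_⟩,
    fun p q => ?_⟩
  · simp [mul_assoc, L.E_left, (hγ _).left, Finset.mul_sum]
  -- Linearity on the inner side: the structure constants from `expand` pass through `E` and `γ`,
  -- and `∑ᵢ E(yₖ n xᵢ) yᵢ = yₖ n` in `M` reassembles them inside `δ`.
  · simp only [AddMonoidHom.finsetSum_apply, AddMonoidHom.comp_apply,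
      AddMonoidHom.mulRight_apply, RingHom.comp_apply, Finset.sum_mul, mul_assoc, expand,
      Finset.mul_sum, map_sum]
    simp only [← mul_assoc, L.E_right, (hγ _).right]
    rw [Finset.sum_comm]
    refine Finset.sum_congr rfl fun k _ => ?_
    simp only [mul_assoc _ (δ _ _) _, ← (hδ _).right]
    conv_rhs => rw [← S₀.sum_left (S₀.y k * f n)]
    simp only [map_sum, (hδ _).left, Finset.mul_sum, ← mul_assoc]
  · simp only [AddMonoidHom.finsetSum_apply, AddMonoidHom.comp_apply,
      AddMonoidHom.coe_mulLeft, RingHom.comp_apply, ← mul_assoc, expand', Finset.sum_mul,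
      map_sum, Finset.mul_sum]
    simp only [mul_assoc _ (L.y _) _, L.E_left, (hβ _).left]
    rw [Finset.sum_comm]
    refine Finset.sum_congr rfl fun k _ => ?_
    simp only [← mul_assoc, ← (hε _).left, ← (hε _).right]
    conv_rhs => rw [← S₀.sum_right (f n * S₀.x k)]
    simp only [map_sum, Finset.sum_mul, ← mul_assoc]
  · simp [← mul_assoc, L.E_right, (hβ _).right, Finset.sum_mul]
  -- Expanding both factors in dual bases leaves the middle term `E(yᵢ xₖ)`, which comes from `N`.
  -- There `h₀` splits it, while `h₁` splits the outer product.
  · have h2 : L.E (p * q) = ∑ i, ∑ k, L.E (p * L.x i) * b (S₀.E (S₀.y i * S₀.x k)) *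
        L.E (L.y k * q) := by
      conv_lhs => rw [← L.sum_left p, ← L.sum_right q]
      simp only [Finset.sum_mul, Finset.mul_sum, map_sum]
      rw [Finset.sum_comm]
      refine Finset.sum_congr rfl fun i _ => Finset.sum_congr rfl fun k _ => ?_
      rw [mul_assoc, L.E_left, ← mul_assoc (L.y i), L.E_right, L.y_eq i, L.x_eq k,
        L.E_g_mul_h, mul_assoc]
    simp only [AddMonoidHom.finsetSum_apply, AddMonoidHom.comp_apply,
      AddMonoidHom.coe_mulLeft, AddMonoidHom.mulRight_apply, h2, map_sum, h₁, (hγ _).right, h₀,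
      Fintype.sum_prod_type, Finset.sum_mul, Finset.mul_sum]
    refine (Finset.sum_congr rfl fun i _ => Finset.sum_comm).trans
      (Finset.sum_comm.trans (Finset.sum_congr rfl fun j' _ => ?_))
    refine (Finset.sum_congr rfl fun i _ => Finset.sum_comm).trans
      (Finset.sum_comm.trans (Finset.sum_congr rfl fun j _ => Finset.sum_comm.trans
        (Finset.sum_congr rfl fun k _ => Finset.sum_congr rfl fun i _ => ?_)))
    simp only [mul_assoc]

end LinkedSystem

end Linked

/-! ### From depth three to a splitting of the form. -/

section DepthThree

variable {A : Type u} {B : Type v} {C : Type w} [Ring A] [Ring B] [Ring C]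
  {ι : Type} [Fintype ι]

theorem BimodHom.map_sum {R S : Type*} [Ring R] [Ring S] {α : R →+* A} {β : S →+* A}
    {X Y : Type u} [AddCommGroup X] [Module A X] [Module Aᵐᵒᵖ X]
    [AddCommGroup Y] [Module A Y] [Module Aᵐᵒᵖ Y] (φ : BimodHom α β X Y)
    {κ : Type*} (s : Finset κ) (x : κ → X) :
    φ.toFun (∑ i ∈ s, x i) = ∑ i ∈ s, φ.toFun (x i) :=
  _root_.map_sum φ.toAddMonoidHom x s

/-- The map `s ⊗ t ↦ (a ↦ s E(t a))`. -/
def FrobeniusSystem.evalRight {g : B →+* A} (S : FrobeniusSystem g ι) :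
    TensorSquare g →+ A →+ A :=
  TensorSquare.lift g
    (AddMonoidHom.mk' (fun s => AddMonoidHom.mk' (fun t =>
      (AddMonoidHom.mulLeft s).comp
        (g.toAddMonoidHom.comp (S.E.comp (AddMonoidHom.mulLeft t))))
      fun t t' => by ext; simp [add_mul, mul_add])
      fun s s' => by ext; simp [add_mul])
    fun x b y => by ext; simp [mul_assoc, S.E_left]

/-- The map `s ⊗ t ↦ (a ↦ E(a s) t)`. -/
def FrobeniusSystem.evalLeft {g : B →+* A} (S : FrobeniusSystem g ι) :
    TensorSquare g →+ A →+ A :=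
  TensorSquare.lift g
    (AddMonoidHom.mk' (fun s => AddMonoidHom.mk' (fun t =>
      (AddMonoidHom.mulRight t).comp
        (g.toAddMonoidHom.comp (S.E.comp (AddMonoidHom.mulRight s))))
      fun t t' => by ext; simp [mul_add])
      fun s s' => by ext; simp [add_mul, mul_add])
    fun x b y => by ext; simp [← mul_assoc, S.E_right]

theorem FrobeniusSystem.evalRight_tmul {g : B →+* A} (S : FrobeniusSystem g ι) (s t a : A) :
    S.evalRight (TensorSquare.tmul g s t) a = s * g (S.E (t * a)) := rfl

theorem FrobeniusSystem.evalLeft_tmul {g : B →+* A} (S : FrobeniusSystem g ι) (s t a : A) :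
    S.evalLeft (TensorSquare.tmul g s t) a = g (S.E (a * s)) * t := rfl

-- All three rules are read off elementary tensors; the last uses right `B`-linearity of `E`. They
-- turn bimodule relations in `A ⊗_B A` into linearity of the associated endomorphisms.
open TensorSquare in
theorem FrobeniusSystem.evalRight_rules {g : B →+* A} (S : FrobeniusSystem g ι)
    (u : TensorSquare g) (a : A) :
    (∀ c, S.evalRight (c • u) a = c * S.evalRight u a) ∧
    (∀ c, S.evalRight (op c • u) a = S.evalRight u (c * a)) ∧
    ∀ b, S.evalRight u (a * g b) = S.evalRight u a * g b := by
  induction u using induction_on with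
  | h0 => simp
  | h1 x y =>
    simp only [smul_tmul, op_smul_tmul, evalRight_tmul, mul_assoc, implies_true, true_and]
    intro b
    rw [← mul_assoc y, S.E_right, map_mul]
  | h2 s t hs ht =>
    simp [smul_add, hs, ht, mul_add, add_mul]

open TensorSquare in
theorem FrobeniusSystem.evalLeft_rules {g : B →+* A} (S : FrobeniusSystem g ι)
    (u : TensorSquare g) (a : A) :
    (∀ c, S.evalLeft (op c • u) a = S.evalLeft u a * c) ∧
    (∀ c, S.evalLeft (c • u) a = S.evalLeft u (a * c)) ∧
    ∀ b, S.evalLeft u (g b * a) = g b * S.evalLeft u a := by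
  induction u using induction_on with
  | h0 => simp
  | h1 x y =>
    simp only [smul_tmul, op_smul_tmul, evalLeft_tmul, mul_assoc, implies_true, true_and]
    intro b
    rw [S.E_left, map_mul, mul_assoc]
  | h2 s t hs ht =>
    simp [smul_add, hs, ht, mul_add, add_mul]

-- The splitting of `A ⊗_B A` off `Aⁿ` writes `1 ⊗ p = ∑ γⱼ(p) uⱼ`, where `uⱼ` is the image of the
-- `j`-th basis vector. Viewing both sides as endomorphisms and evaluating at `q` gives the
-- factorization.
open TensorSquare in
theorem IsRightD3.split {g : B →+* A} {h : C →+* B} (S : FrobeniusSystem g ι)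
    (H : IsRightD3 g h) :
    ∃ (κ : Type) (_ : Fintype κ) (γ β : κ → A →+ A),
      (∀ j, IsBilinear (g.comp h) (g.comp h) (γ j)) ∧
      (∀ j, IsBilinear (g.comp h) (g.comp h) (β j)) ∧
      ∀ p q, g (S.E (p * q)) = ∑ j, γ j p * β j q := by
  obtain ⟨n, -, i, p, hpi⟩ := H
  let e : Fin n → Fin n → A := fun j => Pi.single j 1
  -- Hence `p (e j)` commutes with the image of `C`, and this makes `βⱼ` left `C`-linear.
  have he : ∀ (c : A) j, op c • e j = c • e j := fun c j => by
    ext k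
    by_cases hk : k = j
    · subst hk; simp [e]
    · simp [e, hk]
  refine ⟨Fin n, inferInstance,
    fun j => (Pi.evalAddMonoidHom _ j).comp (i.toAddMonoidHom.comp (tmulHom g 1)),
    fun j => S.evalRight (p.toFun (e j)),
    fun j => ⟨fun c a => ?_, fun c a => ?_⟩, fun j => ⟨fun c a => ?_, fun c a => ?_⟩,
    fun a q => ?_⟩
  · change i.toFun (tmul g 1 (g (h c) * a)) j = g (h c) * i.toFun (tmul g 1 a) j
    rw [← mul_tmul, one_mul]
    have := congrFun (i.map_left (g (h c)) (tmul g 1 a)) j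
    simpa [smul_tmul] using this
  · change i.toFun (tmul g 1 (a * g (h c))) j = i.toFun (tmul g 1 a) j * g (h c)
    have := congrFun (i.map_right c (tmul g 1 a)) j
    simpa [op_smul_tmul] using this
  · have h1 := p.map_right c (e j)
    have h2 := p.map_left (g (h c)) (e j)
    simp only [RingHom.id_apply] at h2
    rw [he] at h1
    rw [← (S.evalRight_rules _ a).2.1, ← (S.evalRight_rules _ a).1]
    exact congrArg (S.evalRight · a) (h1.symm.trans h2)
  · exact (S.evalRight_rules _ a).2.2 (h c)
  · have h1 : tmul g 1 a = ∑ j, i.toFun (tmul g 1 a) j • p.toFun (e j) := by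
      have h3 : ∀ j, i.toFun (tmul g 1 a) j • p.toFun (e j) =
          p.toFun (i.toFun (tmul g 1 a) j • e j) := fun j => (p.map_left _ _).symm
      simp only [h3]
      rw [← p.map_sum]
      conv_lhs => rw [← hpi (tmul g 1 a)]
      congr 1
      ext k
      simp [e, Finset.sum_apply, Pi.single_apply]
    have h2 : S.evalRight (tmul g 1 a) q =
        ∑ j, i.toFun (tmul g 1 a) j * S.evalRight (p.toFun (e j)) q := by
      conv_lhs => rw [h1]
      simp only [map_sum, AddMonoidHom.finsetSum_apply, (S.evalRight_rules _ q).1]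
    rwa [S.evalRight_tmul, one_mul] at h2

-- Mirror image of `IsRightD3.split`, starting from `p ⊗ 1`. The conclusion is the same, so the side
-- of the hypothesis is forgotten from here on.
open TensorSquare in
theorem IsLeftD3.split {g : B →+* A} {h : C →+* B} (S : FrobeniusSystem g ι)
    (H : IsLeftD3 g h) :
    ∃ (κ : Type) (_ : Fintype κ) (γ β : κ → A →+ A),
      (∀ j, IsBilinear (g.comp h) (g.comp h) (γ j)) ∧
      (∀ j, IsBilinear (g.comp h) (g.comp h) (β j)) ∧
      ∀ p q, g (S.E (p * q)) = ∑ j, γ j p * β j q := by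
  obtain ⟨n, -, i, p, hpi⟩ := H
  let e : Fin n → Fin n → A := fun j => Pi.single j 1
  have he : ∀ (c : A) j, op c • e j = c • e j := fun c j => by
    ext k
    by_cases hk : k = j
    · subst hk; simp [e]
    · simp [e, hk]
  refine ⟨Fin n, inferInstance,
    fun j => S.evalLeft (p.toFun (e j)),
    fun j => (Pi.evalAddMonoidHom _ j).comp (i.toAddMonoidHom.comp ((tmulHom g).flip 1)),
    fun j => ⟨fun c a => ?_, fun c a => ?_⟩, fun j => ⟨fun c a => ?_, fun c a => ?_⟩,
    fun q a => ?_⟩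
  · exact (S.evalLeft_rules _ a).2.2 (h c)
  · have h1 := p.map_right (g (h c)) (e j)
    have h2 := p.map_left c (e j)
    simp only [RingHom.id_apply] at h1
    rw [he] at h1
    rw [← (S.evalLeft_rules _ a).2.1, ← (S.evalLeft_rules _ a).1]
    exact congrArg (S.evalLeft · a) (h2.symm.trans h1)
  · change i.toFun (tmul g (g (h c) * a) 1) j = g (h c) * i.toFun (tmul g a 1) j
    have := congrFun (i.map_left c (tmul g a 1)) j
    simpa [smul_tmul] using this
  · change i.toFun (tmul g (a * g (h c)) 1) j = i.toFun (tmul g a 1) j * g (h c)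
    rw [mul_tmul, mul_one]
    have := congrFun (i.map_right (g (h c)) (tmul g a 1)) j
    simpa [op_smul_tmul] using this
  · have h1 : tmul g a 1 = ∑ j, op (i.toFun (tmul g a 1) j) • p.toFun (e j) := by
      have h3 : ∀ j, op (i.toFun (tmul g a 1) j) • p.toFun (e j) =
          p.toFun (op (i.toFun (tmul g a 1) j) • e j) := fun j => (p.map_right _ _).symm
      simp only [h3]
      rw [← p.map_sum]
      conv_lhs => rw [← hpi (tmul g a 1)]
      congr 1
      ext k
      simp [e, Finset.sum_apply, Pi.single_apply]
    have h2 : S.evalLeft (tmul g a 1) q =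
        ∑ j, S.evalLeft (p.toFun (e j)) q * i.toFun (tmul g a 1) j := by
      conv_lhs => rw [h1]
      simp only [map_sum, AddMonoidHom.finsetSum_apply, (S.evalLeft_rules _ q).1]
    rwa [S.evalLeft_tmul, mul_one] at h2

end DepthThree

/-! ### From a split form to depth two. -/

section DepthTwo

variable {A : Type u} {B : Type v} [Ring A] [Ring B] {ι : Type} [Fintype ι]

/-- Summands of finite powers may be presented with components indexed by any finite type. -/
theorem isSummandOfPower_of_fintype {R S : Type*} [Ring R] [Ring S] {α : R →+* A} {β : S →+* A}
    {X : Type u} [AddCommGroup X] [Module A X] [Module Aᵐᵒᵖ X] {κ : Type} [Fintype κ]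
    (i : κ → BimodHom α β X A) (p : κ → BimodHom α β A X)
    (h : ∀ x, ∑ j, (p j).toFun ((i j).toFun x) = x) : IsSummandOfPower α β X A := by
  let e := Fintype.equivFin κ
  -- A zero component is added so that the exponent is positive even when `κ` is empty.
  let i' : Fin (Fintype.card κ + 1) → X →+ A :=
    Fin.cons 0 fun k => (i (e.symm k)).toAddMonoidHom
  let p' : Fin (Fintype.card κ + 1) → A →+ X :=
    Fin.cons 0 fun k => (p (e.symm k)).toAddMonoidHom
  refine ⟨Fintype.card κ + 1, Nat.succ_pos _,
    { toAddMonoidHom := AddMonoidHom.mk' (fun x k => i' k x) fun x y => by ext; simp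
      map_left := fun r x => funext fun k => ?_
      map_right := fun s x => funext fun k => ?_ },
    { toAddMonoidHom := ∑ k, (p' k).comp (Pi.evalAddMonoidHom _ k)
      map_left := fun r x => ?_
      map_right := fun s x => ?_ }, fun x => ?_⟩
  · cases k using Fin.cases with
    | zero => exact (smul_zero (A := A) (α r)).symm
    | succ k => exact (i (e.symm k)).map_left r x
  · cases k using Fin.cases with
    | zero => exact (smul_zero (A := A) (op (β s))).symm
    | succ k => exact (i (e.symm k)).map_right s x
  · change (∑ k, (p' k).comp (Pi.evalAddMonoidHom _ k)) _ =
      α r • (∑ k, (p' k).comp (Pi.evalAddMonoidHom _ k)) _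
    simp only [AddMonoidHom.finsetSum_apply, Finset.smul_sum]
    refine Finset.sum_congr rfl fun k _ => ?_
    cases k using Fin.cases with
    | zero => exact (smul_zero _).symm
    | succ k => exact (p (e.symm k)).map_left r _
  · change (∑ k, (p' k).comp (Pi.evalAddMonoidHom _ k)) _ =
      op (β s) • (∑ k, (p' k).comp (Pi.evalAddMonoidHom _ k)) _
    simp only [AddMonoidHom.finsetSum_apply, Finset.smul_sum]
    refine Finset.sum_congr rfl fun k _ => ?_
    cases k using Fin.cases with
    | zero => exact (smul_zero _).symm
    | succ k => exact (p (e.symm k)).map_right s _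
  · change (∑ k, (p' k).comp (Pi.evalAddMonoidHom _ k)) (fun k => i' k x) = x
    rw [AddMonoidHom.finsetSum_apply, Fin.sum_univ_succ]
    refine (zero_add _).trans (Eq.trans ?_ (h x))
    exact Equiv.sum_comp e.symm fun j => (p j).toFun ((i j).toFun x)

open TensorSquare in
/-- A Frobenius extension `B → A` whose form `E (p q)` splits over `A` is depth two. -/
theorem FrobeniusSystem.isD2 {f : B →+* A} (S : FrobeniusSystem f ι)
    (H : SplitForm f S.E f) : IsD2 f := by
  obtain ⟨κ, _, γ, β, hγ, hβ, H⟩ := H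
  constructor
  -- The decomposition is `x ⊗ y = ∑ⱼ x γⱼ(y) • uⱼ`: summing over `j` first gives `∑ᵢ x E(y xᵢ) ⊗
  -- yᵢ`. Each `uⱼ` commutes with `B` by `casimir`.
  · let u : κ → TensorSquare f := fun j => ∑ i, tmul f (β j (S.x i)) (S.y i)
    have hu : ∀ j b, op (f b) • u j = f b • u j := fun j b => by
      have := S.casimir ((tmulHom f).comp (β j)) (fun x b y => by
        change tmul f (β j (x * f b)) y = tmul f (β j x) (f b * y)
        rw [(hβ j).right, mul_tmul]) (f b)
      simp only [u, Finset.smul_sum, smul_tmul, op_smul_tmul, ← (hβ j).left]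
      exact this.symm
    let δ : κ → TensorSquare f →+ A := fun j =>
      TensorSquare.lift f (AddMonoidHom.mul.compl₂ (γ j)) fun x b y => by
        simp [(hγ j).left, mul_assoc]
    refine isSummandOfPower_of_fintype (κ := κ)
      (fun j =>
        { toAddMonoidHom := δ j
          map_left := fun a t => ?_
          map_right := fun b t => ?_ })
      (fun j =>
        { toAddMonoidHom := (smulAddHom A (TensorSquare f)).flip (u j)
          map_left := fun a x => mul_smul a x (u j)
          map_right := fun b x => ?_ }) fun t => ?_
    · change δ j (a • t) = a * δ j t
      induction t using induction_on with
      | h0 => simp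
      | h1 x y =>
        change a * x * γ j y = a * (x * γ j y)
        rw [mul_assoc]
      | h2 s t hs ht => simp only [smul_add, map_add, hs, ht, mul_add]
    · change δ j (op (f b) • t) = δ j t * f b
      induction t using induction_on with
      | h0 => simp
      | h1 x y =>
        change x * γ j (y * f b) = x * γ j y * f b
        rw [(hγ j).right, mul_assoc]
      | h2 s t hs ht => simp only [smul_add, map_add, hs, ht, add_mul]
    · change (x * f b) • u j = op (f b) • x • u j
      rw [mul_smul, ← hu, smul_op_smul]
    · change ∑ j, δ j t • u j = t
      induction t using induction_on with
      | h0 => simp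
      | h1 x y =>
        simp only [δ, lift_tmul, u, Finset.smul_sum, smul_tmul]
        change ∑ j, ∑ i, tmul f (x * γ j y * β j (S.x i)) (S.y i) = _
        rw [Finset.sum_comm]
        simp only [mul_assoc, ← sum_tmul, ← Finset.mul_sum, ← H, mul_tmul, ← tmul_sum,
          S.sum_left]
      | h2 s t hs ht => simp only [map_add, add_smul, Finset.sum_add_distrib, hs, ht]
  -- Mirror image: `x ⊗ y = ∑ⱼ uⱼ βⱼ(x) y`, so the left depth two condition comes from the same `γ,
  -- β`.
  · let u : κ → TensorSquare f := fun j => ∑ i, tmul f (S.x i) (γ j (S.y i))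
    have hu : ∀ j b, f b • u j = op (f b) • u j := fun j b => by
      have := S.casimir ((tmulHom f).compl₂ (γ j)) (fun x b y => by
        change tmul f (x * f b) (γ j y) = tmul f x (γ j (f b * y))
        rw [(hγ j).left, mul_tmul]) (f b)
      simp only [u, Finset.smul_sum, smul_tmul, op_smul_tmul, ← (hγ j).right]
      exact this
    let δ : κ → TensorSquare f →+ A := fun j =>
      TensorSquare.lift f (AddMonoidHom.mul.comp (β j)) fun x b y => by
        simp [(hβ j).right, mul_assoc]
    refine isSummandOfPower_of_fintype (κ := κ)
      (fun j =>
        { toAddMonoidHom := δ j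
          map_left := fun b t => ?_
          map_right := fun a t => ?_ })
      (fun j =>
        { toAddMonoidHom := AddMonoidHom.mk' (fun a => op a • u j) fun a a' => by
            rw [op_add, add_smul]
          map_left := fun b x => ?_
          map_right := fun a x => ?_ }) fun t => ?_
    · change δ j (f b • t) = f b * δ j t
      induction t using induction_on with
      | h0 => simp
      | h1 x y =>
        change β j (f b * x) * y = f b * (β j x * y)
        rw [(hβ j).left, mul_assoc]
      | h2 s t hs ht => simp only [smul_add, map_add, hs, ht, mul_add]
    · change δ j (op a • t) = δ j t * a
      induction t using induction_on with
      | h0 => simp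
      | h1 x y =>
        change β j x * (y * a) = β j x * y * a
        rw [mul_assoc]
      | h2 s t hs ht => simp only [smul_add, map_add, hs, ht, add_mul]
    · change op (f b * x) • u j = f b • op x • u j
      rw [op_mul, mul_smul, smul_op_smul, hu]
    · change op (x * a) • u j = op a • op x • u j
      rw [op_mul, mul_smul]
    · change ∑ j, op (δ j t) • u j = t
      induction t using induction_on with
      | h0 => simp
      | h1 x y =>
        simp only [δ, u, Finset.smul_sum, op_smul_tmul]
        change ∑ j, ∑ i, tmul f (S.x i) (γ j (S.y i) * (β j x * y)) = _
        rw [Finset.sum_comm]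
        simp only [← mul_assoc, ← tmul_sum, ← Finset.sum_mul, ← H, ← mul_tmul, ← sum_tmul,
          S.sum_right]
      | h2 s t hs ht => simp only [map_add, op_add, add_smul, Finset.sum_add_distrib, hs, ht]

end DepthTwo

/-! ### The Jones tower and the conclusion. -/

section Tower

variable {N : Type v} {M : Type u} [Ring N] [Ring M] (f : N →+* M)

theorem leftRegular_injective {R : Type*} {S : Type*} [Ring R] [Ring S] (s : R →+* S) :
    Function.Injective (leftRegular s) := fun a a' h => by
  have h1 : a * 1 = a' * 1 := DFunLike.congr_fun (congrArg Subtype.val h) (1 : S)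
  simpa using h1

theorem jonesStep_injective (k : ℕ) : Function.Injective (jonesStep f k) := by
  cases k with
  | zero => exact leftRegular_injective f
  | succ k => exact leftRegular_injective (jonesStep f k)

theorem jonesIncl_injective (k : ℕ) : Function.Injective (jonesIncl f k) := by
  induction k with
  | zero => exact Function.injective_id
  | succ k ih => exact (jonesStep_injective f k).comp ih

variable {f} {ι : Type} [Fintype ι]

/-- The Frobenius systems of the steps of the Jones tower. -/
def jonesSystem (S₀ : FrobeniusSystem f ι) :
    (k : ℕ) → LinkedSystem S₀ (jonesBase f k) (jonesStep f k)
  | 0 => (LinkedSystem.refl S₀).next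
  | k + 1 => (jonesSystem S₀ k).next

/-- The target `A` is independent of `k`, so the induction can climb to `M_{n-2}` while splitting
over that ring throughout. -/
theorem exists_jonesBase_system (S₀ : FrobeniusSystem f ι) (k : ℕ) :
    ∃ (κ : Type) (_ : Fintype κ) (S : FrobeniusSystem (jonesBase f k) κ),
      ∀ (A : Type u) [Ring A] (α : N →+* A), SplitForm f S₀.E α →
        SplitForm (jonesBase f k) S.E α := by
  induction k with
  | zero => exact ⟨ι, inferInstance, S₀, fun _ _ _ h => h⟩
  | succ k ih =>
    obtain ⟨κ, _, S, hS⟩ := ih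
    exact ⟨ι × κ, inferInstance, (jonesSystem S₀ k).toFrobeniusSystem.comp S,
      fun A _ α h => (jonesSystem S₀ k).splitForm h (hS A α h)⟩

theorem isD2_of_hasDepth (hf : IsFrobeniusExtension f) {n : ℕ} (h : HasDepth f n) :
    IsFrobeniusExtension (jonesBase f (n - 2)) ∧ IsD2 (jonesBase f (n - 2)) := by
  obtain ⟨E, hl, hr, m, x, y, hxy⟩ := hf
  let S₀ : FrobeniusSystem f (Fin m) :=
    ⟨E, hl, hr, x, y, fun a => (hxy a).1, fun a => (hxy a).2⟩
  obtain ⟨κ, _, S, hS⟩ := exists_jonesBase_system S₀ (n - 2)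
  refine ⟨S.isFrobeniusExtension, S.isD2 (hS _ _ ?_)⟩
  -- Depths 0 and 1 are `False`. In depth 2 the form of `N → M` splits directly over `M`; in depth
  -- `k + 3` the splitting over `M_{k+1}` is pulled back along `L.g` and `L.h`.
  match n, h with
  | 2, h => exact h.elim (fun h => h.split S₀) (fun h => h.split S₀)
  | k + 3, h =>
    let L := jonesSystem S₀ k
    obtain ⟨κ, _, γ, β, hγ, hβ, H⟩ :=
      h.elim (fun h => h.split L.toFrobeniusSystem) (fun h => h.split L.toFrobeniusSystem)
    exact ⟨κ, inferInstance, fun j => (γ j).comp L.g, fun j => (β j).comp L.h,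
      fun j => (hγ j).comp L.g_bilinear, fun j => (hβ j).comp L.h_bilinear,
      fun p q => (congrArg (jonesStep f k) (L.E_g_mul_h p q)).symm.trans (H _ _)⟩

end Tower

end FrobDepth

theorem mainTheorem4 {N : Type v} {M : Type u} [Ring N] [Ring M] (f : N →+* M)
    (hf : FrobDepth.IsFrobeniusExtension f) :
    (∀ m n : ℕ, 0 < m → n = 2 ^ m + 1 → FrobDepth.HasDepth f n →
      FrobDepth.IsFrobeniusExtension (FrobDepth.jonesBase f (n - 2)) ∧
      FrobDepth.IsD2 (FrobDepth.jonesBase f (n - 2)) ∧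
      Function.Injective (FrobDepth.jonesIncl f (n - 2))) ∧
    ((∃ n : ℕ, FrobDepth.HasDepth f n) →
      ∃ k : ℕ, FrobDepth.IsFrobeniusExtension (FrobDepth.jonesBase f k) ∧
        FrobDepth.IsD2 (FrobDepth.jonesBase f k) ∧
        Function.Injective (FrobDepth.jonesIncl f k)) :=
  ⟨fun _ _ _ _ h =>
      have := FrobDepth.isD2_of_hasDepth hf h
      ⟨this.1, this.2, FrobDepth.jonesIncl_injective f _⟩,
    fun ⟨_, h⟩ =>
      have := FrobDepth.isD2_of_hasDepth hf h
      ⟨_, this.1, this.2, FrobDepth.jonesIncl_injective f _⟩⟩
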